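/- Let $k$ be an algebraically closed field of characteristic $p \ge 3$ and let $(\mathfrak g,[p])$ be a finite-dimensional restricted Lie algebra over $k$. A torus of $\mathfrak g$ is an abelian subalgebra that is stable under the $p$-map and on which the $p$-map is bijective. The $p$-rank of $\mathfrak g$ is the maximal dimension of a subspace $\mathfrak e \subseteq \mathfrak g$ such that $[\mathfrak e,\mathfrak e]=(0)$ and $x^{[p]}=0$ for all $x\in\mathfrak e$. For a torus $\mathfrak t \subseteq \mathfrak g$, the roots of $\mathfrak g$ relative to $\mathfrak t$ are the non-zero linear forms $\alpha \in \mathfrak t^\ast$ for which $\mathfrak g_\alpha := \{x \in \mathfrak g : [h,x]=\alpha(h)x \text{ for all } h \in \mathfrak t\}$ is non-zero. Suppose that $\mathfrak g$ has $p$-rank $1$, and let $\mathfrak t$ be a torus of $\mathfrak g$ of maximal dimension (among all tori of $\mathfrak g$) such that there are at least two roots of $\mathfrak g$ relative to $\mathfrak t$. Then the centralizer $C_{\mathfrak g}(\mathfrak t)$ of $\mathfrak t$ in $\mathfrak g$ equals $\mathfrak t$; in particular $\mathfrak g$ is generically toral, that is, $\mathfrak g$ possesses a torus that is its own centralizer.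 -/

import Mathlib

open scoped TensorProduct Polynomial

namespace RestrictedLie

section Coefficients

variable {L : Type*} [LieRing L]

/-- `adCoeff x y n j` is the coefficient of `T ^ j` in `ad (x ⊗ T + y ⊗ 1) ^ n (x ⊗ 1)`, where
`T` is an indeterminate (see `ad_pow_eq_sum_adCoeff`). -/
def adCoeff (x y : L) : ℕ → ℕ → L
  | 0, 0 => x
  | 0, _ + 1 => 0
  | n + 1, 0 => ⁅y, adCoeff x y n 0⁆
  | n + 1, j + 1 => ⁅x, adCoeff x y n j⁆ + ⁅y, adCoeff x y n (j + 1)⁆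

theorem adCoeff_eq_zero (x y : L) : ∀ n j : ℕ, n < j → adCoeff x y n j = 0
  | 0, 0, h => absurd h (lt_irrefl 0)
  | 0, _ + 1, _ => rfl
  | _ + 1, 0, h => absurd h (Nat.not_lt_zero _)
  | n + 1, j + 1, h => by
      rw [adCoeff, adCoeff_eq_zero x y n j (by omega), adCoeff_eq_zero x y n (j + 1) (by omega),
        lie_zero, lie_zero, add_zero]

/-- The defining property of `adCoeff`, in the Lie algebra `k[T] ⊗ L` over `k[T]`. -/
theorem ad_pow_eq_sum_adCoeff (k : Type*) [Field k] [LieAlgebra k L] (x y : L) (n : ℕ) :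
    ((LieAlgebra.ad k[X] (k[X] ⊗[k] L) ((Polynomial.X : k[X]) ⊗ₜ[k] x + (1 : k[X]) ⊗ₜ[k] y)) ^ n)
        ((1 : k[X]) ⊗ₜ[k] x) =
      ∑ j ∈ Finset.range (n + 1), ((Polynomial.X : k[X]) ^ j) ⊗ₜ[k] adCoeff x y n j := by
  induction n with
  | zero => simp [adCoeff]
  | succ n ih =>
    rw [pow_succ', Module.End.mul_apply, ih, Finset.sum_range_succ' _ (n + 1), map_sum]
    simp only [LieAlgebra.ad_apply, add_lie, LieAlgebra.ExtendScalars.bracket_tmul, one_mul,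
      Finset.sum_add_distrib, adCoeff, TensorProduct.tmul_add, pow_succ', pow_zero]
    rw [add_assoc]
    congr 1
    rw [Finset.sum_range_succ' _ n, Finset.sum_range_succ _ n,
      adCoeff_eq_zero x y n (n + 1) (Nat.lt_succ_self n)]
    simp [pow_succ']

end Coefficients

/-- Jacobson's Lie polynomials `s_i(x, y)`, `1 ≤ i ≤ p - 1`, given by
`ad (x ⊗ T + y ⊗ 1) ^ (p - 1) (x ⊗ 1) = ∑ i s_i(x, y) ⊗ T ^ (i - 1)`. -/
def jacobsonPoly (k : Type*) {L : Type*} [Field k] [LieRing L] [LieAlgebra k L]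
    (p : ℕ) (x y : L) (i : ℕ) : L :=
  ((i : k)⁻¹) • adCoeff x y (p - 1) (i - 1)

/-- A `p`-map `x ↦ x^[p]` on a Lie algebra `L` over a field `k` of characteristic `p`; the pair
consisting of `L` and a `p`-map is a restricted Lie algebra. -/
structure PMap (p : ℕ) (k L : Type*) [Field k] [LieRing L] [LieAlgebra k L] where
  toFun : L → L
  ad_toFun : ∀ x : L, LieAlgebra.ad k L (toFun x) = (LieAlgebra.ad k L x) ^ p
  smul_toFun : ∀ (a : k) (x : L), toFun (a • x) = a ^ p • toFun x
  add_toFun : ∀ x y : L,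
    toFun (x + y) = toFun x + toFun y + ∑ i ∈ Finset.Icc 1 (p - 1), jacobsonPoly k p x y i

instance (p : ℕ) (k L : Type*) [Field k] [LieRing L] [LieAlgebra k L] :
    CoeFun (PMap p k L) (fun _ => L → L) where
  coe P := P.toFun

section Notions

variable {p : ℕ} {k L : Type*} [Field k] [LieRing L] [LieAlgebra k L]

/-- The nullcone `V(L) = {x | x^[p] = 0}`. -/
def nullcone (P : PMap p k L) : Set L := {x | P x = 0}

/-- The set `𝔼(r, L)` of `r`-dimensional elementary abelian subalgebras: the `r`-dimensional
subspaces `e` with `[e, e] = 0` and `e ⊆ V(L)`. -/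
def elementaryAbelian (P : PMap p k L) (r : ℕ) : Set (Submodule k L) :=
  {e | Module.finrank k e = r ∧ (∀ x ∈ e, ∀ y ∈ e, ⁅x, y⁆ = 0) ∧ (e : Set L) ⊆ nullcone P}

/-- The `p`-rank of `L` (for `L` finite-dimensional the supremum is a maximum). -/
noncomputable def pRank (P : PMap p k L) : ℕ := sSup {r | (elementaryAbelian P r).Nonempty}

/-- A subalgebra `t` is a torus if it is stable under the `p`-map, abelian, and the `p`-map of `t`
is bijective. -/
def IsTorus (P : PMap p k L) (t : LieSubalgebra k L) : Prop :=
  (∀ x ∈ t, ∀ y ∈ t, ⁅x, y⁆ = 0) ∧ Set.BijOn P (t : Set L) (t : Set L)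

/-- `t` is a torus whose dimension is the maximal dimension of all tori of `L`. -/
def IsMaxDimTorus (P : PMap p k L) (t : LieSubalgebra k L) : Prop :=
  IsTorus P t ∧ ∀ t' : LieSubalgebra k L, IsTorus P t' → Module.finrank k t' ≤ Module.finrank k t

/-- The centralizer of a subalgebra `t` in `L`. -/
def centralizer (t : LieSubalgebra k L) : LieSubalgebra k L where
  carrier := {x | ∀ y ∈ t, ⁅x, y⁆ = 0}
  zero_mem' := fun y _ => zero_lie y
  add_mem' := fun ha hb y hy => by rw [add_lie, ha y hy, hb y hy, add_zero]
  smul_mem' := fun c a ha y hy => by rw [smul_lie, ha y hy, smul_zero]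
  lie_mem' := fun {a b} ha hb y hy => by rw [lie_lie, hb y hy, ha y hy, lie_zero, lie_zero, sub_zero]

/-- The set `R_t ⊆ t* \ {0}` of roots of `L` relative to `t`: the non-zero linear forms `α` on `t`
whose root space `{x | [h, x] = α(h) x for all h ∈ t}` is non-zero. -/
def roots (t : LieSubalgebra k L) : Set (Module.Dual k t) :=
  {α | α ≠ 0 ∧ LieModule.weightSpace L (α : t → k) ≠ ⊥}

/-- `L` is generically toral if it has a self-centralizing torus. -/
def IsGenericallyToral (P : PMap p k L) : Prop :=
  ∃ t : LieSubalgebra k L, IsTorus P t ∧ centralizer t = t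

end Notions

end RestrictedLie

/-! Suppose `centralizer t ≠ t`. High `p`-powers of elements of the centralizer lie in `t`, so
correcting by an element of `t` gives a nonzero `x` centralizing `t` with `P x = 0`. Let `H` be the
common centralizer of `t` and `x`. Rank one forces every element of the nullcone commuting with `x`
into `k x`, with three consequences. A dimension count excludes Heisenberg algebras in the
centralizer of `x` (`lie_eq_zero_of_lie_lie_eq_zero`). Hence `H`, which is nilpotent by Engel, is
abelian. And the `p`-map, being semilinear on `H` with kernel in `k x`, has as image all of `H` or
the kernel of a linear form `l` on `H`.

The contradiction comes from the weights of `H`. A `p`-th power of an element of `H` cannot be the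
`p`-th power of a sum having components of nonzero weight (`eq_zero_of_map_eq`). So it suffices to
find a sum of weight vectors whose `p`-th power lies in `H` and is killed by `l`, one equation,
solvable over an algebraically closed field. On a commuting pair of weight vectors this shows that
distinct nonzero weights have nonzero bracket (`lie_ne_zero`). Two such weights therefore produce an
opposite pair, which spans with its bracket a Heisenberg algebra or an `sl2`; the latter is excluded
by solving the equation on the conic of its nilpotent elements (`lie_eq_zero_of_sl2`). Thus `H` has
at most one nonzero weight and `t` at most one root. -/

namespace RestrictedLie

/-! ### Rank-nullity for Frobenius-semilinear maps. -/

section Semilinear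

/-- Rank-nullity for maps that are semilinear with respect to a field automorphism. -/
theorem finrank_range_add_finrank_ker_of_bijective {k V W : Type*} [Field k] [AddCommGroup V]
    [Module k V] [FiniteDimensional k V] [AddCommGroup W] [Module k W] {σ : k →+* k}
    [RingHomSurjective σ] (hσ : Function.Bijective σ) (f : V →ₛₗ[σ] W) :
    Module.finrank k (LinearMap.range f) + Module.finrank k (LinearMap.ker f) =
      Module.finrank k V := by
  have h : Module.finrank k (V ⧸ LinearMap.ker f) = Module.finrank k (LinearMap.range f) := by
    let e : (V ⧸ LinearMap.ker f) ≃+ LinearMap.range f :=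
      AddEquiv.ofBijective
        (((LinearMap.ker f).liftQ f.rangeRestrict
          (by rw [LinearMap.ker_rangeRestrict])).toAddMonoidHom) (by
        constructor
        · rw [injective_iff_map_eq_zero]
          intro a ha
          induction a using Submodule.Quotient.induction_on with
          | H z =>
            rw [Submodule.Quotient.mk_eq_zero, LinearMap.mem_ker]
            exact congrArg Subtype.val ha
        · rintro ⟨_, z, rfl⟩
          exact ⟨Submodule.Quotient.mk z, rfl⟩)
    have := congrArg Cardinal.toNat (lift_rank_eq_of_equiv_equiv σ e hσ fun c z ↦ by
      induction z using Submodule.Quotient.induction_on with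
      | H z => exact Subtype.ext (map_smulₛₗ f c z))
    simpa only [Cardinal.toNat_lift, Module.finrank] using this
  rw [← h, Submodule.finrank_quotient_add_finrank]

end Semilinear

/-! ### Additivity of the `p`-map and commutation with `p`-powers. -/

section PMapBasics

variable {p : ℕ} {k L : Type*} [Field k] [LieRing L] [LieAlgebra k L] (P : PMap p k L)

theorem adCoeff_eq_zero_of_lie_lie_eq_zero {x y : L} (hx : ⁅x, ⁅x, y⁆⁆ = 0)
    (hy : ⁅y, ⁅x, y⁆⁆ = 0) (n j : ℕ) : adCoeff x y (n + 2) j = 0 := by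
  have hx' : ⁅x, ⁅y, x⁆⁆ = 0 := by rw [← lie_skew y x, lie_neg, hx, neg_zero]
  have hy' : ⁅y, ⁅y, x⁆⁆ = 0 := by rw [← lie_skew y x, lie_neg, hy, neg_zero]
  induction n generalizing j with
  | zero =>
    rcases j with _ | _ | _ | j <;> simp [adCoeff, hx', hy']
  | succ n ih =>
    cases j with
    | zero => rw [adCoeff, ih, lie_zero]
    | succ j => rw [adCoeff, ih, ih, lie_zero, lie_zero, add_zero]

/-- Jacobson's polynomials consist of brackets of length `p ≥ 3`, which vanish in nilpotency class
two. This is what makes the `p`-map semilinear on Heisenberg algebras too. -/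
theorem PMap.map_add_of_lie_lie_eq_zero (hp : 3 ≤ p) {x y : L} (hx : ⁅x, ⁅x, y⁆⁆ = 0)
    (hy : ⁅y, ⁅x, y⁆⁆ = 0) : P (x + y) = P x + P y := by
  obtain ⟨q, rfl⟩ := Nat.exists_eq_add_of_le' hp
  rw [P.add_toFun, Finset.sum_eq_zero, add_zero]
  intro i _
  rw [jacobsonPoly, show q + 3 - 1 = q + 2 by omega, adCoeff_eq_zero_of_lie_lie_eq_zero hx hy,
    smul_zero]

theorem PMap.map_add_of_commute (hp : 3 ≤ p) {x y : L} (h : ⁅x, y⁆ = 0) :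
    P (x + y) = P x + P y :=
  P.map_add_of_lie_lie_eq_zero hp (by rw [h, lie_zero]) (by rw [h, lie_zero])

theorem PMap.map_zero (hp : p ≠ 0) : P 0 = 0 := by
  have := P.smul_toFun 0 0
  rwa [zero_smul, zero_pow hp, zero_smul] at this

theorem PMap.lie_apply (x y : L) : ⁅P x, y⁆ = ((LieAlgebra.ad k L x) ^ p) y := by
  rw [← P.ad_toFun, LieAlgebra.ad_apply]

theorem ad_pow_apply_eq_zero {x y : L} {m n : ℕ} (h : ((LieAlgebra.ad k L x) ^ m) y = 0)
    (hmn : m ≤ n) : ((LieAlgebra.ad k L x) ^ n) y = 0 := by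
  obtain ⟨q, rfl⟩ := Nat.exists_eq_add_of_le' hmn
  rw [pow_add, Module.End.mul_apply, h, _root_.map_zero]

theorem PMap.lie_apply_eq_zero_of_pow {x y : L} {m : ℕ}
    (h : ((LieAlgebra.ad k L x) ^ m) y = 0) (hm : m ≤ p) : ⁅P x, y⁆ = 0 := by
  rw [P.lie_apply, ad_pow_apply_eq_zero h hm]

theorem PMap.lie_apply_eq_zero (hp : p ≠ 0) {x y : L} (h : ⁅x, y⁆ = 0) : ⁅P x, y⁆ = 0 :=
  P.lie_apply_eq_zero_of_pow (m := 1) (by simpa using h) (Nat.one_le_iff_ne_zero.mpr hp)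

theorem PMap.lie_apply_self (hp : p ≠ 0) (x : L) : ⁅P x, x⁆ = 0 :=
  P.lie_apply_eq_zero hp (lie_self x)

theorem lie_eq_zero_comm {x y : L} : ⁅x, y⁆ = 0 ↔ ⁅y, x⁆ = 0 := by
  rw [← lie_skew, neg_eq_zero]

theorem PMap.lie_iterate_eq_zero (hp : p ≠ 0) {x y : L} (h : ⁅x, y⁆ = 0) (n : ℕ) :
    ⁅P^[n] x, y⁆ = 0 := by
  induction n with
  | zero => exact h
  | succ n ih => rw [Function.iterate_succ_apply']; exact P.lie_apply_eq_zero hp ih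

theorem PMap.lie_iterate_right_eq_zero (hp : p ≠ 0) {x y : L} (h : ⁅x, y⁆ = 0) (n : ℕ) :
    ⁅x, P^[n] y⁆ = 0 :=
  lie_eq_zero_comm.mp (P.lie_iterate_eq_zero hp (lie_eq_zero_comm.mp h) n)

theorem PMap.map_sub_of_commute [Fact p.Prime] (hp : 3 ≤ p) {x y : L} (h : ⁅x, y⁆ = 0) :
    P (x - y) = P x - P y := by
  have hodd : Odd p := (Fact.out : p.Prime).odd_of_ne_two (by omega)
  rw [sub_eq_add_neg, ← neg_one_smul k y, P.map_add_of_commute hp (by rw [lie_smul, h, smul_zero]),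
    P.smul_toFun, hodd.neg_one_pow, neg_one_smul, ← sub_eq_add_neg]

theorem ad_pow_eq_of_iterate (n : ℕ) (x : L) :
    LieAlgebra.ad k L (P^[n] x) = (LieAlgebra.ad k L x) ^ (p ^ n) := by
  induction n with
  | zero => simp
  | succ n ih => rw [Function.iterate_succ_apply', P.ad_toFun, ih, ← pow_mul, ← pow_succ]

end PMapBasics

section PMapSemilinear

variable {p : ℕ} [Fact p.Prime] {k L : Type*} [Field k] [IsAlgClosed k] [CharP k p] [LieRing L]
  [LieAlgebra k L] (P : PMap p k L)

instance : RingHomSurjective (frobenius k p) := ⟨surjective_frobenius k p⟩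

/-- The `p`-map on a subspace on which it is additive, as a semilinear map. -/
def PMap.semilinear (A : Submodule k L) (hA : ∀ a ∈ A, ∀ b ∈ A, P (a + b) = P a + P b) :
    A →ₛₗ[frobenius k p] L where
  toFun a := P a
  map_add' a b := hA a a.2 b b.2
  map_smul' c a := P.smul_toFun c a

theorem PMap.finrank_range_add_finrank_ker [FiniteDimensional k L] (A : Submodule k L)
    (hA : ∀ a ∈ A, ∀ b ∈ A, P (a + b) = P a + P b) :
    Module.finrank k (LinearMap.range (P.semilinear A hA)) +
      Module.finrank k (LinearMap.ker (P.semilinear A hA)) = Module.finrank k A :=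
  finrank_range_add_finrank_ker_of_bijective (bijective_frobenius k p) _

end PMapSemilinear

/-! ### Brackets and `p`-th powers on spans. -/

section Span

variable {k L : Type*} [Field k] [LieRing L] [LieAlgebra k L]

theorem lie_eq_zero_of_mem_span {S T : Set L} (h : ∀ a ∈ S, ∀ b ∈ T, ⁅a, b⁆ = 0) {x y : L}
    (hx : x ∈ Submodule.span k S) (hy : y ∈ Submodule.span k T) : ⁅x, y⁆ = 0 := by
  have h1 : ∀ a ∈ S, ⁅a, y⁆ = 0 := fun a ha ↦ by
    induction hy using Submodule.span_induction with
    | mem b hb => exact h a ha b hb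
    | zero => exact lie_zero a
    | add u v _ _ hu hv => rw [lie_add, hu, hv, add_zero]
    | smul c u _ hu => rw [lie_smul, hu, smul_zero]
  induction hx using Submodule.span_induction with
  | mem a ha => exact h1 a ha
  | zero => exact zero_lie y
  | add u v _ _ hu hv => rw [add_lie, hu, hv, add_zero]
  | smul c u _ hu => rw [smul_lie, hu, smul_zero]

theorem lie_mem_span_of_mem_span {S T U : Set L} (h : ∀ a ∈ S, ∀ b ∈ T, ⁅a, b⁆ ∈ Submodule.span k U)
    {x y : L} (hx : x ∈ Submodule.span k S) (hy : y ∈ Submodule.span k T) :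
    ⁅x, y⁆ ∈ Submodule.span k U := by
  have h1 : ∀ a ∈ S, ⁅a, y⁆ ∈ Submodule.span k U := fun a ha ↦ by
    induction hy using Submodule.span_induction with
    | mem b hb => exact h a ha b hb
    | zero => rw [lie_zero]; exact zero_mem _
    | add u v _ _ hu hv => rw [lie_add]; exact add_mem hu hv
    | smul c u _ hu => rw [lie_smul]; exact Submodule.smul_mem _ c hu
  induction hx using Submodule.span_induction with
  | mem a ha => exact h1 a ha
  | zero => rw [zero_lie]; exact zero_mem _
  | add u v _ _ hu hv => rw [add_lie]; exact add_mem hu hv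
  | smul c u _ hu => rw [smul_lie]; exact Submodule.smul_mem _ c hu

theorem PMap.map_mem_of_mem_span {p : ℕ} (hp : p ≠ 0) (P : PMap p k L) {S : Set L}
    {U : Submodule k L}
    (hadd : ∀ a ∈ Submodule.span k S, ∀ b ∈ Submodule.span k S, P (a + b) = P a + P b)
    (h : ∀ a ∈ S, P a ∈ U) {x : L} (hx : x ∈ Submodule.span k S) : P x ∈ U := by
  induction hx using Submodule.span_induction with
  | mem a ha => exact h a ha
  | zero => rw [P.map_zero hp]; exact zero_mem _
  | add u v hu hv hu' hv' => rw [hadd u hu v hv]; exact add_mem hu' hv'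
  | smul c u _ hu => rw [P.smul_toFun]; exact Submodule.smul_mem _ _ hu

end Span

/-! ### Consequences of `p`-rank one. -/

section Rank

variable {p : ℕ} {k L : Type*} [Field k] [LieRing L] [LieAlgebra k L] [FiniteDimensional k L]
  {P : PMap p k L}

theorem finrank_le_pRank {r : ℕ} {e : Submodule k L} (he : e ∈ elementaryAbelian P r) :
    r ≤ pRank P := by
  refine le_csSup ⟨Module.finrank k L, ?_⟩ ⟨e, he⟩
  rintro _ ⟨e, rfl, _⟩
  exact Submodule.finrank_le e

/-- In a restricted Lie algebra of `p`-rank one, commuting elements of the nullcone are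
proportional. -/
theorem exists_smul_eq_of_pRank_eq_one (hp : 3 ≤ p) (hrank : pRank P = 1) {u v : L} (hu : P u = 0)
    (hv : P v = 0) (huv : ⁅u, v⁆ = 0) (hu0 : u ≠ 0) : ∃ c : k, c • u = v := by
  by_contra! hc
  have hli : LinearIndependent k ![u, v] := (LinearIndependent.pair_iff' hu0).mpr hc
  have hcomm : ∀ a ∈ ({u, v} : Set L), ∀ b ∈ ({u, v} : Set L), ⁅a, b⁆ = 0 := by
    rintro a (rfl | rfl) b (rfl | rfl)
    exacts [lie_self _, huv, lie_eq_zero_comm.mp huv, lie_self _]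
  have hmem : Submodule.span k {u, v} ∈ elementaryAbelian P 2 := by
    refine ⟨?_, fun x hx y hy ↦ lie_eq_zero_of_mem_span hcomm hx hy, fun x hx ↦ ?_⟩
    · have := finrank_span_eq_card hli
      rwa [Matrix.range_cons, Matrix.range_cons, Matrix.range_empty, Set.union_empty,
        Set.singleton_union, Fintype.card_fin] at this
    · refine (Submodule.mem_bot k).mp (P.map_mem_of_mem_span (by omega) (fun a ha b hb ↦
        P.map_add_of_commute hp (lie_eq_zero_of_mem_span hcomm ha hb)) ?_ hx)
      rintro a (rfl | rfl)
      exacts [(Submodule.mem_bot k).mpr hu, (Submodule.mem_bot k).mpr hv]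
  have := finrank_le_pRank hmem
  omega

end Rank

/-! ### Tori of maximal dimension. -/

section Torus

variable {p : ℕ} {k L : Type*} [Field k] [LieRing L] [LieAlgebra k L] {P : PMap p k L}
  {t : LieSubalgebra k L}

theorem IsTorus.le_centralizer (ht : IsTorus P t) : t ≤ centralizer t :=
  fun x hx y hy ↦ ht.1 x hx y hy

theorem PMap.map_mem_centralizer (hp : p ≠ 0) (P : PMap p k L) {x : L} (hx : x ∈ centralizer t) :
    P x ∈ centralizer t := fun y hy ↦ P.lie_apply_eq_zero hp (hx y hy)

theorem PMap.iterate_mem_centralizer (hp : p ≠ 0) (P : PMap p k L) {x : L}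
    (hx : x ∈ centralizer t) (n : ℕ) : P^[n] x ∈ centralizer t :=
  fun y hy ↦ P.lie_iterate_eq_zero hp (hx y hy) n

theorem PMap.iterate_sub_of_commute [Fact p.Prime] (hp : 3 ≤ p) (P : PMap p k L) {x y : L}
    (h : ⁅x, y⁆ = 0) (n : ℕ) : P^[n] (x - y) = P^[n] x - P^[n] y := by
  induction n with
  | zero => rfl
  | succ n ih =>
    rw [Function.iterate_succ_apply', ih, P.map_sub_of_commute hp, Function.iterate_succ_apply',
      Function.iterate_succ_apply']
    exact P.lie_iterate_eq_zero (by omega) (P.lie_iterate_right_eq_zero (by omega) h n) n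

/-- A torus of maximal dimension absorbs sufficiently high `p`-powers of its centralizer. -/
theorem IsMaxDimTorus.exists_iterate_mem [Fact p.Prime] [IsAlgClosed k] [CharP k p]
    [FiniteDimensional k L] (hp : 3 ≤ p) (ht : IsMaxDimTorus P t) {h : L}
    (hh : h ∈ centralizer t) : ∃ n, P^[n] h ∈ t := by
  have hp0 : p ≠ 0 := by omega
  let G : ℕ → Set L := fun n ↦ (t : Set L) ∪ {z | ∃ i, n ≤ i ∧ P^[i] h = z}
  have hself : ∀ i j, ⁅P^[i] h, P^[j] h⁆ = 0 := fun i j ↦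
    P.lie_iterate_eq_zero hp0 (P.lie_iterate_right_eq_zero hp0 (lie_self h) j) i
  have hG : ∀ n, ∀ a ∈ G n, ∀ b ∈ G n, ⁅a, b⁆ = 0 := by
    rintro n a (ha | ⟨i, -, rfl⟩) b (hb | ⟨j, -, rfl⟩)
    · exact ht.1.1 a ha b hb
    · exact lie_eq_zero_comm.mp (P.lie_iterate_eq_zero hp0 (hh a ha) j)
    · exact P.lie_iterate_eq_zero hp0 (hh b hb) i
    · exact hself i j
  -- The abelian spaces `T n` decrease and the `p`-map sends `T n` onto a space containing `T (n +
  -- 1)`. Once they stabilize it is surjective on `T n`, hence injective by rank-nullity, so `T n`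
  -- is a torus containing `t`.
  let T : ℕ → Submodule k L := fun n ↦ Submodule.span k (G n)
  have hab : ∀ n, ∀ a ∈ T n, ∀ b ∈ T n, ⁅a, b⁆ = 0 := fun n a ha b hb ↦
    lie_eq_zero_of_mem_span (hG n) ha hb
  have hadd : ∀ n, ∀ a ∈ T n, ∀ b ∈ T n, P (a + b) = P a + P b := fun n a ha b hb ↦
    P.map_add_of_commute hp (hab n a ha b hb)
  have hle : ∀ n, T (n + 1) ≤ LinearMap.range (P.semilinear (T n) (hadd n)) := by
    intro n
    refine Submodule.span_le.mpr ?_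
    rintro z (hz | ⟨i, hi, rfl⟩)
    · obtain ⟨y, hy, rfl⟩ := ht.1.2.surjOn hz
      exact ⟨⟨y, Submodule.subset_span (Or.inl hy)⟩, rfl⟩
    · obtain ⟨j, rfl⟩ := Nat.exists_eq_add_of_le' hi
      exact ⟨⟨P^[j + n] h, Submodule.subset_span (Or.inr ⟨j + n, by omega, rfl⟩)⟩,
        (Function.iterate_succ_apply' P (j + n) h).symm⟩
  have hmaps : ∀ n, ∀ a ∈ T n, P a ∈ T n := by
    refine fun n a ha ↦ P.map_mem_of_mem_span hp0 (hadd n) ?_ ha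
    rintro z (hz | ⟨i, hi, rfl⟩)
    · exact Submodule.subset_span (Or.inl (ht.1.2.mapsTo hz))
    · exact Submodule.subset_span (Or.inr ⟨i + 1, by omega, Function.iterate_succ_apply' P i h⟩)
  have hanti : Antitone T := by
    intro m n hmn
    refine Submodule.span_mono (Set.union_subset_union_right _ ?_)
    rintro z ⟨i, hi, rfl⟩
    exact ⟨i, hmn.trans hi, rfl⟩
  obtain ⟨n, hn⟩ := IsArtinian.monotone_stabilizes
    (⟨fun n ↦ OrderDual.toDual (T n), fun _ _ h ↦ hanti h⟩ : ℕ →o (Submodule k L)ᵒᵈ)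
  have hTn : T n = T (n + 1) := hn (n + 1) (Nat.le_succ n)
  have hrange : LinearMap.range (P.semilinear (T n) (hadd n)) = T n := by
    refine le_antisymm ?_ (hTn.le.trans (hle n))
    rintro _ ⟨a, rfl⟩
    exact hmaps n a a.2
  have hker : LinearMap.ker (P.semilinear (T n) (hadd n)) = ⊥ := by
    have := P.finrank_range_add_finrank_ker (T n) (hadd n)
    rw [hrange] at this
    exact Submodule.finrank_eq_zero.mp (by omega)
  let T' : LieSubalgebra k L :=
    { T n with lie_mem' := fun {a b} ha hb ↦ (hab n a ha b hb).symm ▸ (T n).zero_mem }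
  have hT' : IsTorus P T' := by
    refine ⟨hab n, hmaps n, fun a ha b hb hab' ↦ ?_, fun a ha ↦ ?_⟩
    · exact congrArg Subtype.val (LinearMap.ker_eq_bot.mp hker
        (a₁ := (⟨a, ha⟩ : T n)) (a₂ := (⟨b, hb⟩ : T n)) hab')
    · obtain ⟨b, hb⟩ : a ∈ LinearMap.range (P.semilinear (T n) (hadd n)) := hrange.symm ▸ ha
      exact ⟨b, b.2, hb⟩
  have hsub : t.toSubmodule ≤ T n := fun z hz ↦ Submodule.subset_span (Or.inl hz)
  have heq : t.toSubmodule = T n := Submodule.eq_of_le_of_finrank_le hsub (ht.2 T' hT')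
  have hmem : P^[n] h ∈ T n := Submodule.subset_span (Or.inr ⟨n, le_rfl, rfl⟩)
  rw [← heq] at hmem
  exact ⟨n, hmem⟩

theorem IsMaxDimTorus.exists_ne_zero_map_eq_zero [Fact p.Prime] [IsAlgClosed k] [CharP k p]
    [FiniteDimensional k L] (hp : 3 ≤ p) (ht : IsMaxDimTorus P t) (hne : centralizer t ≠ t) :
    ∃ x ∈ centralizer t, x ≠ 0 ∧ P x = 0 := by
  obtain ⟨h, hh, hht⟩ : ∃ h ∈ centralizer t, h ∉ t := by
    by_contra! hall
    exact hne (le_antisymm hall ht.1.le_centralizer)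
  obtain ⟨n, hn⟩ := ht.exists_iterate_mem hp hh
  -- Subtracting `s`, which has the same iterated `p`-power as `h`, leaves a nonzero element killed
  -- by an iterate of `P`; its last nonzero iterate is the required one.
  obtain ⟨s, hs, hsn⟩ := (ht.1.2.iterate n).surjOn hn
  have h0 : P^[n] (h - s) = 0 := by
    rw [P.iterate_sub_of_commute hp (hh s hs), hsn, sub_self]
  have hne0 : h - s ≠ 0 := fun h' ↦ hht (by rwa [sub_eq_zero.mp h'])
  have hmem : h - s ∈ centralizer t := sub_mem hh (ht.1.le_centralizer hs)
  classical
  have hex : ∃ m, P^[m] (h - s) = 0 := ⟨n, h0⟩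
  obtain ⟨m, hm⟩ : ∃ m, Nat.find hex = m + 1 :=
    Nat.exists_eq_succ_of_ne_zero fun h' ↦ hne0 ((Nat.find_eq_zero hex).mp h')
  refine ⟨P^[m] (h - s), P.iterate_mem_centralizer (by omega) hmem m,
    Nat.find_min hex (by omega), ?_⟩
  rw [← Function.iterate_succ_apply' (f := (P : L → L)), Nat.succ_eq_add_one, ← hm]
  exact Nat.find_spec hex

end Torus

/-! ### Nonzero central commutators in nilpotent Lie algebras. -/

section Nilpotent

/-- The last nonzero term of the lower central series is central and generated by brackets; it lies
in the derived algebra because `L` is not abelian. -/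
theorem exists_lie_ne_zero_of_isNilpotent {L : Type*} [LieRing L] [LieRing.IsNilpotent L]
    (h : ∃ x y : L, ⁅x, y⁆ ≠ 0) : ∃ z w : L, ⁅z, w⁆ ≠ 0 ∧ ∀ u : L, ⁅u, ⁅z, w⁆⁆ = 0 := by
  classical
  have hex : ∃ n, LieModule.lowerCentralSeries ℤ L L n = ⊥ := LieModule.IsNilpotent.nilpotent ℤ L L
  have hlie : ∀ {n u v}, v ∈ LieModule.lowerCentralSeries ℤ L L n →
      ⁅u, v⁆ ∈ LieModule.lowerCentralSeries ℤ L L (n + 1) := fun {n u v} hv ↦ by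
    rw [LieModule.lowerCentralSeries_succ]
    exact LieSubmodule.lie_mem_lie (LieSubmodule.mem_top u) hv
  have hspec := Nat.find_spec hex
  obtain ⟨x, y, hxy⟩ := h
  obtain ⟨m, hm⟩ : ∃ m, Nat.find hex = m + 2 := by
    refine Nat.exists_eq_add_of_le' ?_
    by_contra! hlt
    have h1 : LieModule.lowerCentralSeries ℤ L L 1 = ⊥ :=
      le_bot_iff.mp (hspec ▸ LieModule.antitone_lowerCentralSeries ℤ L L (Nat.lt_succ_iff.mp hlt))
    have : ⁅x, y⁆ ∈ LieModule.lowerCentralSeries ℤ L L 1 := hlie (n := 0) (by simp)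
    rw [h1] at this
    exact hxy this
  rw [hm] at hspec
  have hmin : LieModule.lowerCentralSeries ℤ L L (m + 1) ≠ ⊥ := Nat.find_min hex (by omega)
  by_contra! hall
  refine hmin ?_
  rw [LieModule.lowerCentralSeries_succ, LieSubmodule.lie_eq_bot_iff]
  intro z _ w hw
  by_contra hne
  obtain ⟨u, hu⟩ := hall z w hne
  have := hlie (u := u) (hlie (u := z) hw)
  rw [hspec] at this
  exact hu this

end Nilpotent

/-! ### No Heisenberg algebra centralizes `x`. -/

section Heisenberg

variable {p : ℕ} [Fact p.Prime] {k L : Type*} [Field k] [IsAlgClosed k] [CharP k p] [LieRing L]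
  [LieAlgebra k L] [FiniteDimensional k L] {P : PMap p k L}

/-- The kernel of the `p`-map on `A` lies in the nullcone and commutes with `x`, hence lies in `k
x`. -/
theorem finrank_le_finrank_range_add_one (hp : 3 ≤ p) (hrank : pRank P = 1) {x : L} (hx0 : x ≠ 0)
    (hPx : P x = 0) (A : Submodule k L) (hA : ∀ a ∈ A, ∀ b ∈ A, P (a + b) = P a + P b)
    (hAx : ∀ a ∈ A, ⁅a, x⁆ = 0) :
    Module.finrank k A ≤ Module.finrank k (LinearMap.range (P.semilinear A hA)) + 1 := by
  rw [← P.finrank_range_add_finrank_ker A hA, Nat.add_le_add_iff_left,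
    ← Submodule.finrank_map_subtype_eq, ← finrank_span_singleton (K := k) hx0]
  refine Submodule.finrank_mono ?_
  rintro _ ⟨a, ha, rfl⟩
  exact Submodule.mem_span_singleton.mpr (exists_smul_eq_of_pRank_eq_one hp hrank hPx ha
    (lie_eq_zero_comm.mp (hAx a a.2)) hx0)

/-- The centralizer of a nonzero element of the nullcone of a restricted Lie algebra of `p`-rank
one contains no Heisenberg algebra. -/
theorem lie_eq_zero_of_lie_lie_eq_zero (hp : 3 ≤ p) (hrank : pRank P = 1) {x : L} (hx0 : x ≠ 0)
    (hPx : P x = 0) {z w : L} (hzx : ⁅z, x⁆ = 0) (hwx : ⁅w, x⁆ = 0) (hz : ⁅z, ⁅z, w⁆⁆ = 0)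
    (hw : ⁅w, ⁅z, w⁆⁆ = 0) : ⁅z, w⁆ = 0 := by
  by_contra hc
  have hp0 : p ≠ 0 := by omega
  set c := ⁅z, w⁆ with hcdef
  have hzw : ∀ i, ⁅P^[i] (P z), w⁆ = 0 :=
    P.lie_iterate_eq_zero hp0 (P.lie_apply_eq_zero_of_pow (m := 2)
      (by rw [pow_two, Module.End.mul_apply, LieAlgebra.ad_apply, LieAlgebra.ad_apply]; exact hz)
      (by omega))
  have hwz : ∀ i, ⁅P^[i] (P w), z⁆ = 0 := by
    refine P.lie_iterate_eq_zero hp0 (P.lie_apply_eq_zero_of_pow (m := 2) ?_ (by omega))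
    rw [pow_two, Module.End.mul_apply, LieAlgebra.ad_apply, LieAlgebra.ad_apply,
      ← lie_skew w z, ← hcdef, lie_neg, hw, neg_zero]
  have hzz : ∀ i j, ⁅P^[i] z, P^[j] z⁆ = 0 := fun i j ↦
    P.lie_iterate_eq_zero hp0 (P.lie_iterate_right_eq_zero hp0 (lie_self z) j) i
  have hww : ∀ i j, ⁅P^[i] w, P^[j] w⁆ = 0 := fun i j ↦
    P.lie_iterate_eq_zero hp0 (P.lie_iterate_right_eq_zero hp0 (lie_self w) j) i
  let G : ℕ → Set L := fun n ↦ {v | ∃ i, n ≤ i ∧ (v = P^[i] z ∨ v = P^[i] w ∨ v = P^[i] c)}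
  have hzG : z ∈ G 0 := ⟨0, le_rfl, Or.inl rfl⟩
  have hwG : w ∈ G 0 := ⟨0, le_rfl, Or.inr (Or.inl rfl)⟩
  have hcG : ∀ a ∈ G 0, ∀ j, ⁅a, P^[j] c⁆ = 0 := by
    rintro a ⟨i, -, rfl | rfl | rfl⟩ j <;>
      refine P.lie_iterate_eq_zero hp0 (P.lie_iterate_right_eq_zero hp0 ?_ j) i
    exacts [hz, hw, lie_self c]
  have hzwij : ∀ i j, ⁅P^[i] z, P^[j] w⁆ ∈ Submodule.span k {c} := by
    intro i j
    rcases i with _ | i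
    · rcases j with _ | j
      · exact Submodule.mem_span_singleton_self c
      · have : ⁅z, P^[j + 1] w⁆ = 0 := lie_eq_zero_comm.mp (hwz j)
        exact this.symm ▸ zero_mem _
    · have : ⁅P^[i + 1] z, P^[j] w⁆ = 0 := P.lie_iterate_right_eq_zero hp0 (hzw i) j
      exact this.symm ▸ zero_mem _
  have hGG : ∀ a ∈ G 0, ∀ b ∈ G 0, ⁅a, b⁆ ∈ Submodule.span k {c} := by
    intro a ha b hb
    have ha' := ha
    have hb' := hb
    obtain ⟨i, -, rfl | rfl | rfl⟩ := ha
    · obtain ⟨j, -, rfl | rfl | rfl⟩ := hb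
      · exact (hzz i j).symm ▸ zero_mem _
      · exact hzwij i j
      · exact (hcG _ ha' j).symm ▸ zero_mem _
    · obtain ⟨j, -, rfl | rfl | rfl⟩ := hb
      · rw [← lie_skew]
        exact neg_mem (hzwij j i)
      · exact (hww i j).symm ▸ zero_mem _
      · exact (hcG _ ha' j).symm ▸ zero_mem _
    · rw [← lie_skew, hcG b hb' i, neg_zero]
      exact zero_mem _
  -- `A` is spanned by all iterated `p`-powers of `z`, `w`, `c`, and `B` by the proper ones, so `P`
  -- maps `A` into `B`. As `B` centralizes `z` and `w`, these are independent modulo `B`. Thus the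
  -- image has codimension at least two in `A`, whereas rank one allows at most one.
  let A : Submodule k L := Submodule.span k (G 0)
  let B : Submodule k L := Submodule.span k (G 1)
  have hcent : ∀ a ∈ A, ∀ b ∈ Submodule.span k {c}, ⁅a, b⁆ = 0 := fun a ha b hb ↦
    lie_eq_zero_of_mem_span (fun a ha b hb ↦ Set.mem_singleton_iff.mp hb ▸ hcG a ha 0) ha hb
  have hadd : ∀ a ∈ A, ∀ b ∈ A, P (a + b) = P a + P b := fun a ha b hb ↦
    have hab := lie_mem_span_of_mem_span hGG ha hb
    P.map_add_of_lie_lie_eq_zero hp (hcent a ha _ hab) (hcent b hb _ hab)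
  have hrange : LinearMap.range (P.semilinear A hadd) ≤ B := by
    rintro _ ⟨a, rfl⟩
    refine P.map_mem_of_mem_span hp0 hadd (fun v hv ↦ Submodule.subset_span ?_) a.2
    obtain ⟨i, -, hi⟩ := hv
    refine ⟨i + 1, by omega, ?_⟩
    rcases hi with rfl | rfl | rfl <;> simp [Function.iterate_succ_apply' (P : L → L)]
  have hBA : B ≤ A := Submodule.span_mono fun v ⟨i, _, hi⟩ ↦ ⟨i, Nat.zero_le i, hi⟩
  have hAx : ∀ a ∈ A, ⁅a, x⁆ = 0 := by
    refine fun a ha ↦ lie_eq_zero_of_mem_span (T := {x}) ?_ ha (Submodule.mem_span_singleton_self x)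
    rintro a ⟨i, -, rfl | rfl | rfl⟩ b hb <;> rw [Set.mem_singleton_iff.mp hb] <;>
      refine P.lie_iterate_eq_zero hp0 ?_ i
    · exact hzx
    · exact hwx
    · rw [hcdef, lie_lie, hzx, hwx, lie_zero, lie_zero, sub_zero]
  have hBz : ∀ b ∈ B, ⁅b, z⁆ = 0 := by
    refine fun b hb ↦ lie_eq_zero_of_mem_span (T := {z}) ?_ hb (Submodule.mem_span_singleton_self z)
    rintro a ⟨_ | i, hi, ha⟩ b hb <;> [omega; rw [Set.mem_singleton_iff.mp hb]]
    rcases ha with rfl | rfl | rfl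
    exacts [hzz (i + 1) 0, hwz i, lie_eq_zero_comm.mp (hcG z hzG (i + 1))]
  have hBw : ∀ b ∈ B, ⁅b, w⁆ = 0 := by
    refine fun b hb ↦ lie_eq_zero_of_mem_span (T := {w}) ?_ hb (Submodule.mem_span_singleton_self w)
    rintro a ⟨_ | i, hi, ha⟩ b hb <;> [omega; rw [Set.mem_singleton_iff.mp hb]]
    rcases ha with rfl | rfl | rfl
    exacts [hzw i, hww (i + 1) 0, lie_eq_zero_comm.mp (hcG w hwG (i + 1))]
  have hindep : ∀ r s : k, r • z + s • w ∈ B → r = 0 ∧ s = 0 := by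
    intro r s h
    constructor
    · have := hBw _ h
      rw [add_lie, smul_lie, smul_lie, lie_self, smul_zero, add_zero, ← hcdef] at this
      exact (smul_eq_zero.mp this).resolve_right hc
    · have := hBz _ h
      rw [add_lie, smul_lie, smul_lie, lie_self, smul_zero, zero_add, ← lie_skew, ← hcdef,
        smul_neg, neg_eq_zero] at this
      exact (smul_eq_zero.mp this).resolve_right hc
  have hli : LinearIndependent k ![z, w] :=
    LinearIndependent.pair_iff.mpr fun r s h ↦ hindep r s (h.symm ▸ zero_mem _)
  have hrk : Module.finrank k (Submodule.span k {z, w}) = 2 := by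
    have := finrank_span_eq_card hli
    rwa [Matrix.range_cons, Matrix.range_cons, Matrix.range_empty, Set.union_empty,
      Set.singleton_union, Fintype.card_fin] at this
  have hinf : B ⊓ Submodule.span k {z, w} = ⊥ := by
    rw [eq_bot_iff]
    rintro v ⟨hvB, hv⟩
    obtain ⟨r, s, rfl⟩ := Submodule.mem_span_pair.mp hv
    obtain ⟨rfl, rfl⟩ := hindep r s hvB
    simp
  have hsup : B ⊔ Submodule.span k {z, w} ≤ A := by
    refine sup_le hBA (Submodule.span_le.mpr ?_)
    rintro v (rfl | rfl)
    exacts [Submodule.subset_span hzG, Submodule.subset_span hwG]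
  have h1 := Submodule.finrank_sup_add_finrank_inf_eq B (Submodule.span k {z, w})
  rw [hinf, finrank_bot, hrk] at h1
  have h2 := Submodule.finrank_mono hsup
  have h3 := Submodule.finrank_mono hrange
  have h4 := finrank_le_finrank_range_add_one hp hrank hx0 hPx A hadd hAx
  omega

end Heisenberg

/-! ### The common centralizer of `t` and `x` is abelian. -/

section Cartan

variable {p : ℕ} {k L : Type*} [Field k] [LieRing L] [LieAlgebra k L]

/-- The elements centralizing both the subalgebra `t` and the element `x`. -/
def centralizerAdjoin (t : LieSubalgebra k L) (x : L) : LieSubalgebra k L where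
  carrier := {h | h ∈ centralizer t ∧ ⁅h, x⁆ = 0}
  zero_mem' := ⟨zero_mem _, zero_lie x⟩
  add_mem' := fun ha hb ↦ ⟨add_mem ha.1 hb.1, by rw [add_lie, ha.2, hb.2, add_zero]⟩
  smul_mem' := fun c a ha ↦ ⟨(centralizer t).smul_mem c ha.1, by rw [smul_lie, ha.2, smul_zero]⟩
  lie_mem' := fun {a b} ha hb ↦ ⟨(centralizer t).lie_mem ha.1 hb.1, by
    rw [lie_lie, hb.2, ha.2, lie_zero, lie_zero, sub_zero]⟩

theorem PMap.map_mem_centralizerAdjoin {t : LieSubalgebra k L} {x h : L} (hp : p ≠ 0)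
    (P : PMap p k L) (hh : h ∈ centralizerAdjoin t x) : P h ∈ centralizerAdjoin t x :=
  ⟨P.map_mem_centralizer hp hh.1, P.lie_apply_eq_zero hp hh.2⟩

/-- Nilpotency follows from Engel's theorem; if the algebra were not abelian, a nonzero central
commutator would give a Heisenberg algebra centralizing `x`. -/
theorem lie_eq_zero_of_mem_centralizerAdjoin [Fact p.Prime] [IsAlgClosed k] [CharP k p]
    [FiniteDimensional k L] {P : PMap p k L} {t : LieSubalgebra k L} (hp : 3 ≤ p)
    (hrank : pRank P = 1) (ht : IsMaxDimTorus P t) {x : L} (hx0 : x ≠ 0) (hPx : P x = 0) {a b : L}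
    (ha : a ∈ centralizerAdjoin t x) (hb : b ∈ centralizerAdjoin t x) : ⁅a, b⁆ = 0 := by
  have hnil : LieRing.IsNilpotent (centralizerAdjoin t x) := by
    rw [LieAlgebra.isNilpotent_iff_forall (R := k)]
    intro h
    -- Since `P^[n] h` lies in `t`, it acts trivially, and its adjoint action is the `p ^ n`-th
    -- power of that of `h`.
    obtain ⟨n, hn⟩ := ht.exists_iterate_mem hp h.2.1
    refine ⟨p ^ n, LinearMap.ext fun y ↦ Subtype.ext ?_⟩
    have : ⁅P^[n] (h : L), (y : L)⁆ = 0 := lie_eq_zero_comm.mp (y.2.1 _ hn)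
    rw [LieSubalgebra.coe_ad_pow]
    rwa [← LieAlgebra.ad_apply (R := k), ad_pow_eq_of_iterate] at this
  by_contra hab
  obtain ⟨z, w, hzw, hcent⟩ := exists_lie_ne_zero_of_isNilpotent (L := centralizerAdjoin t x)
    ⟨⟨a, ha⟩, ⟨b, hb⟩, fun h ↦ hab (congrArg Subtype.val h)⟩
  exact hzw (Subtype.ext (lie_eq_zero_of_lie_lie_eq_zero hp hrank hx0 hPx z.2.2 w.2.2
    (congrArg Subtype.val (hcent z)) (congrArg Subtype.val (hcent w))))

end Cartan

/-! ### The `p`-map as a polynomial map; zeros on conics. -/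

section PolynomialMaps

variable {p : ℕ} {k L : Type*} [Field k] [LieRing L] [LieAlgebra k L]

/-- The `L`-valued polynomial functions on `k`. -/
def polynomialMaps (k L : Type*) [Field k] [LieRing L] [LieAlgebra k L] : Submodule k (k → L) :=
  Submodule.span k {f | ∃ (j : ℕ) (v : L), f = fun c ↦ c ^ j • v}

theorem pow_smul_mem_polynomialMaps (j : ℕ) (v : L) :
    (fun c : k ↦ c ^ j • v) ∈ polynomialMaps k L :=
  Submodule.subset_span ⟨j, v, rfl⟩

theorem lie_mem_polynomialMaps {f g : k → L} (hf : f ∈ polynomialMaps k L)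
    (hg : g ∈ polynomialMaps k L) : (fun c ↦ ⁅f c, g c⁆) ∈ polynomialMaps k L := by
  have hgen : ∀ (i : ℕ) (v : L), (fun c ↦ ⁅c ^ i • v, g c⁆) ∈ polynomialMaps k L := by
    intro i v
    induction hg using Submodule.span_induction with
    | mem g hg =>
      obtain ⟨j, w, rfl⟩ := hg
      refine Submodule.subset_span ⟨i + j, ⁅v, w⁆, funext fun c ↦ ?_⟩
      rw [smul_lie, lie_smul, smul_smul, pow_add]
    | zero =>
      simp only [Pi.zero_apply, lie_zero]
      exact zero_mem _
    | add f g _ _ hf hg =>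
      simp only [Pi.add_apply, lie_add]
      exact add_mem hf hg
    | smul c f _ hf =>
      simp only [Pi.smul_apply, lie_smul]
      exact Submodule.smul_mem _ c hf
  induction hf using Submodule.span_induction with
  | mem f hf =>
    obtain ⟨i, v, rfl⟩ := hf
    exact hgen i v
  | zero =>
    simp only [Pi.zero_apply, zero_lie]
    exact zero_mem _
  | add f g _ _ hf hg =>
    simp only [Pi.add_apply, add_lie]
    exact add_mem hf hg
  | smul c f _ hf =>
    simp only [Pi.smul_apply, smul_lie]
    exact Submodule.smul_mem _ c hf

theorem adCoeff_mem_polynomialMaps {f g : k → L} (hf : f ∈ polynomialMaps k L)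
    (hg : g ∈ polynomialMaps k L) (n j : ℕ) :
    (fun c ↦ adCoeff (f c) (g c) n j) ∈ polynomialMaps k L := by
  induction n generalizing j with
  | zero =>
    cases j with
    | zero => exact hf
    | succ j => exact zero_mem _
  | succ n ih =>
    cases j with
    | zero => exact lie_mem_polynomialMaps hg (ih 0)
    | succ j =>
      exact add_mem (lie_mem_polynomialMaps hf (ih j)) (lie_mem_polynomialMaps hg (ih (j + 1)))

theorem PMap.comp_mem_polynomialMaps (hp : p ≠ 0) (P : PMap p k L) {f : k → L}
    (hf : f ∈ polynomialMaps k L) : (fun c ↦ P (f c)) ∈ polynomialMaps k L := by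
  induction hf using Submodule.span_induction with
  | mem f hf =>
    obtain ⟨j, v, rfl⟩ := hf
    refine Submodule.subset_span ⟨j * p, P v, funext fun c ↦ ?_⟩
    rw [P.smul_toFun, pow_mul]
  | zero =>
    have : (fun c : k ↦ P ((0 : k → L) c)) = 0 := funext fun c ↦ P.map_zero hp
    rw [this]
    exact zero_mem _
  | add f g hf hg hf' hg' =>
    have : (fun c ↦ P ((f + g) c)) = (fun c ↦ P (f c)) + (fun c ↦ P (g c)) +
        ∑ i ∈ Finset.Icc 1 (p - 1), ((i : k)⁻¹) • fun c ↦ adCoeff (f c) (g c) (p - 1) (i - 1) := by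
      funext c
      simp only [Pi.add_apply, P.add_toFun, Finset.sum_apply, Pi.smul_apply, jacobsonPoly]
    rw [this]
    exact add_mem (add_mem hf' hg')
      (sum_mem fun i _ ↦ Submodule.smul_mem _ _ (adCoeff_mem_polynomialMaps hf hg _ _))
  | smul c f _ hf =>
    have : (fun d ↦ P ((c • f) d)) = c ^ p • fun d ↦ P (f d) := funext fun d ↦ P.smul_toFun c (f d)
    rw [this]
    exact Submodule.smul_mem _ _ hf

theorem exists_polynomial_eq_eval (l : Module.Dual k L) {f : k → L}
    (hf : f ∈ polynomialMaps k L) : ∃ q : k[X], ∀ c, l (f c) = q.eval c := by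
  induction hf using Submodule.span_induction with
  | mem f hf =>
    obtain ⟨j, v, rfl⟩ := hf
    exact ⟨Polynomial.C (l v) * Polynomial.X ^ j, fun c ↦ by
      simp only [map_smul, smul_eq_mul, Polynomial.eval_mul, Polynomial.eval_C,
        Polynomial.eval_pow, Polynomial.eval_X, mul_comm]⟩
  | zero => exact ⟨0, fun c ↦ by simp⟩
  | add f g _ _ hf hg =>
    obtain ⟨q, hq⟩ := hf
    obtain ⟨r, hr⟩ := hg
    exact ⟨q + r, fun c ↦ by simp [hq, hr]⟩
  | smul c f _ hf =>
    obtain ⟨q, hq⟩ := hf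
    exact ⟨Polynomial.C c * q, fun d ↦ by simp [hq]⟩

/-- A linear form composed with the `p`-map has a nontrivial zero on every conic
`a ^ 2 • u + (a * b) • v + b ^ 2 • w`. -/
theorem PMap.exists_conic_zero [IsAlgClosed k] (hp : p ≠ 0) (P : PMap p k L) (l : Module.Dual k L)
    (u v w : L) : ∃ a b : k, (a ≠ 0 ∨ b ≠ 0) ∧
      l (P (a ^ 2 • u + (a * b) • v + b ^ 2 • w)) = 0 := by
  have hmem : ∀ u v w : L, (fun c : k ↦ c ^ 0 • u + c ^ 1 • v + c ^ 2 • w) ∈ polynomialMaps k L :=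
    fun u v w ↦ add_mem (add_mem (pow_smul_mem_polynomialMaps 0 u)
      (pow_smul_mem_polynomialMaps 1 v)) (pow_smul_mem_polynomialMaps 2 w)
  obtain ⟨q, hq⟩ := exists_polynomial_eq_eval l (P.comp_mem_polynomialMaps hp (hmem u v w))
  obtain ⟨r, hr⟩ := exists_polynomial_eq_eval l (P.comp_mem_polynomialMaps hp (hmem w v u))
  simp only [pow_zero, pow_one, one_smul] at hq hr
  -- The polynomials `q` and `r` describe the two affine charts of the projective line of
  -- parameters. A nonzero constant `q` has no root, but then the zero is at infinity. The zero
  -- polynomial falls in the other case.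
  by_cases hdeg : q.degree = 0
  · rw [Polynomial.eq_C_of_degree_eq_zero hdeg] at hq
    simp only [Polynomial.eval_C] at hq
    refine ⟨0, 1, Or.inr one_ne_zero, ?_⟩
    -- The conic has degree 2 and `P` degree `p`, so `r` is `q` reversed in degree `2 * p`. The
    -- factor `X` makes the identity trivial at 0, where the change of chart is undefined.
    have hpoly : Polynomial.X * (r - Polynomial.C (q.coeff 0) * Polynomial.X ^ (2 * p)) = 0 := by
      refine Polynomial.funext fun c ↦ ?_
      rcases eq_or_ne c 0 with rfl | hc
      · simp
      · have h1 : w + c • v + c ^ 2 • u = c ^ 2 • (u + c⁻¹ • v + (c⁻¹) ^ 2 • w) := by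
          match_scalars <;> field_simp
        have h2 := hr c
        rw [h1, P.smul_toFun, map_smul, hq, smul_eq_mul, ← pow_mul] at h2
        simp only [Polynomial.eval_mul, Polynomial.eval_X, Polynomial.eval_sub, Polynomial.eval_C,
          Polynomial.eval_pow, Polynomial.eval_zero, ← h2]
        ring
    have h3 := (mul_eq_zero.mp hpoly).resolve_left Polynomial.X_ne_zero
    have h4 := hr 0
    rw [sub_eq_zero.mp h3] at h4
    simp only [Polynomial.eval_mul, Polynomial.eval_pow, Polynomial.eval_X, ne_eq, mul_eq_zero,
      OfNat.ofNat_ne_zero, hp, or_self, not_false_eq_true, zero_pow, mul_zero, zero_smul,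
      add_zero] at h4
    simpa using h4
  · obtain ⟨c, hc⟩ := IsAlgClosed.exists_root q hdeg
    refine ⟨1, c, Or.inl one_ne_zero, ?_⟩
    rw [one_pow, one_smul, one_mul, hq]
    exact hc

end PolynomialMaps

/-! ### Opposite elements in sets almost closed under addition. -/

section Combinatorics

/-- A set of nonzero elements of an abelian group of exponent `p`, in which the sum of any two
distinct elements is again an element or zero, contains opposite elements if it has two elements. -/
theorem exists_mem_neg_mem_of_add_mem {M : Type*} [AddCommGroup M] {p : ℕ} (hp : p ≠ 0)
    (hpM : ∀ m : M, p • m = 0) {R : Set M} (h0 : (0 : M) ∉ R)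
    (hR : ∀ a ∈ R, ∀ b ∈ R, a ≠ b → a + b = 0 ∨ a + b ∈ R) {a b : M} (ha : a ∈ R) (hb : b ∈ R)
    (hab : a ≠ b) : ∃ c ∈ R, -c ∈ R := by
  by_contra! hneg
  -- Without opposite elements, adding `a` never leaves `R`. Taking `m = p - 1` gives `b - a ∈ R`,
  -- and by symmetry `a - b ∈ R`.
  have key : ∀ a ∈ R, ∀ b ∈ R, b ≠ a → ∀ m : ℕ, b + m • a ∈ R ∧ b + m • a ≠ a := by
    intro a ha b hb hba m
    induction m with
    | zero => simpa using ⟨hb, hba⟩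
    | succ m ih =>
      rw [succ_nsmul, ← add_assoc]
      rcases hR _ ih.1 _ ha ih.2 with h | h
      · exact absurd (eq_neg_of_add_eq_zero_left h ▸ ih.1) (hneg a ha)
      · exact ⟨h, fun h' ↦ h0 (add_eq_right.mp h' ▸ ih.1)⟩
  have hsub : ∀ a ∈ R, ∀ b ∈ R, b ≠ a → b - a ∈ R := by
    intro a ha b hb hba
    have h1 := (key a ha b hb hba (p - 1)).1
    have h2 : (p - 1) • a = -a := by
      rw [eq_neg_iff_add_eq_zero, ← succ_nsmul, Nat.sub_add_cancel (Nat.one_le_iff_ne_zero.mpr hp),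
        hpM]
    rwa [h2, ← sub_eq_add_neg] at h1
  refine hneg _ (hsub a ha b hb hab.symm) ?_
  rw [neg_sub]
  exact hsub b hb a ha hab

end Combinatorics

/-! ### Simultaneous eigenvectors of abelian subalgebras. -/

section WeightVectors

variable {p : ℕ} {k L : Type*} [Field k] [LieRing L] [LieAlgebra k L] {H : LieSubalgebra k L}

/-- `y` is a simultaneous eigenvector of `H` with eigenvalues given by `χ`. -/
def IsWeightVector (H : LieSubalgebra k L) (χ : H → k) (y : L) : Prop :=
  ∀ h : H, ⁅(h : L), y⁆ = χ h • y

namespace IsWeightVector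

variable {χ ψ : H → k} {y z : L}

theorem smul (hy : IsWeightVector H χ y) (c : k) : IsWeightVector H χ (c • y) := fun h ↦ by
  rw [lie_smul, hy h, smul_comm]

theorem lie (hy : IsWeightVector H χ y) (hz : IsWeightVector H ψ z) :
    IsWeightVector H (χ + ψ) ⁅y, z⁆ := fun h ↦ by
  rw [leibniz_lie, hy h, hz h, smul_lie, lie_smul, ← add_smul, Pi.add_apply]

theorem lie_right (hy : IsWeightVector H χ y) (h : H) : ⁅y, (h : L)⁆ = -(χ h • y) := by
  rw [← lie_skew, hy h]

theorem ad_pow (hy : IsWeightVector H χ y) (h : H) (n : ℕ) :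
    ((LieAlgebra.ad k L (h : L)) ^ n) y = χ h ^ n • y := by
  induction n with
  | zero => simp
  | succ n ih =>
    rw [pow_succ', Module.End.mul_apply, ih, map_smul, LieAlgebra.ad_apply, hy h, smul_smul,
      pow_succ]

theorem eq_zero_of_ne (hy : IsWeightVector H χ y) (hy' : IsWeightVector H ψ y) (hne : χ ≠ ψ) :
    y = 0 := by
  obtain ⟨h, hh⟩ := Function.ne_iff.mp hne
  have h1 : (χ h - ψ h) • y = 0 := by rw [sub_smul, ← hy h, ← hy' h, sub_self]
  exact (smul_eq_zero.mp h1).resolve_left (sub_ne_zero.mpr hh)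

theorem eq_zero_of_add_eq_zero (hy : IsWeightVector H χ y) (hz : IsWeightVector H ψ z)
    (hne : χ ≠ ψ) (h : y + z = 0) : y = 0 ∧ z = 0 := by
  have hz0 : z = 0 := by
    refine hz.eq_zero_of_ne (ψ := χ) ?_ hne.symm
    rw [eq_neg_of_add_eq_zero_right h, ← neg_one_smul k]
    exact hy.smul _
  exact ⟨by rwa [hz0, add_zero] at h, hz0⟩

end IsWeightVector

/-- A nonzero subspace stable under an abelian subalgebra contains a simultaneous eigenvector. -/
theorem exists_isWeightVector [IsAlgClosed k] [FiniteDimensional k L]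
    (hH : ∀ a ∈ H, ∀ b ∈ H, ⁅a, b⁆ = 0) (W : Submodule k L) (hW : W ≠ ⊥)
    (hHW : ∀ a ∈ H, ∀ w ∈ W, ⁅a, w⁆ ∈ W) : ∃ χ : H → k, ∃ y ∈ W, y ≠ 0 ∧ IsWeightVector H χ y := by
  induction hn : Module.finrank k W using Nat.strong_induction_on generalizing W with
  | _ n ih =>
    by_cases hsc : ∀ h : H, ∃ c : k, ∀ w ∈ W, ⁅(h : L), w⁆ = c • w
    · choose χ hχ using hsc
      obtain ⟨y, hy, hy0⟩ := W.exists_mem_ne_zero_of_ne_bot hW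
      exact ⟨χ, y, hy, hy0, fun h ↦ hχ h y hy⟩
    · push Not at hsc
      obtain ⟨h, hh⟩ := hsc
      have : Nontrivial W := Submodule.nontrivial_iff_ne_bot.mpr hW
      obtain ⟨c, hc⟩ := Module.End.exists_eigenvalue
        ((LieAlgebra.ad k L (h : L)).restrict (p := W) (q := W) fun w hw ↦ hHW h h.2 w hw)
      obtain ⟨v, hv⟩ := hc.exists_hasEigenvector
      have hv1 : ⁅(h : L), (v : L)⁆ = c • (v : L) := congrArg Subtype.val hv.apply_eq_smul
      -- An eigenspace of a non-scalar `h` is a smaller nonzero subspace, stable because `H` is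
      -- abelian.
      let W' : Submodule k L := W ⊓ LinearMap.ker (LieAlgebra.ad k L (h : L) - c • LinearMap.id)
      have hmem : ∀ w, w ∈ W' ↔ w ∈ W ∧ ⁅(h : L), w⁆ = c • w := fun w ↦ by
        simp [W', sub_eq_zero]
      have hlt : W' < W := by
        refine lt_of_le_of_ne inf_le_left fun heq ↦ ?_
        obtain ⟨w, hw, hne⟩ := hh c
        exact hne ((hmem w).mp (heq.symm ▸ hw)).2
      obtain ⟨χ, y, hy, hy0, hχ⟩ := ih _ (hn ▸ Submodule.finrank_lt_finrank_of_lt hlt) W'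
        (fun hbot ↦ hv.2 (Subtype.ext ((Submodule.mem_bot k).mp
          (hbot ▸ (hmem v).mpr ⟨v.2, hv1⟩)))) (fun a ha w hw ↦ by
          obtain ⟨hw, hw'⟩ := (hmem w).mp hw
          refine (hmem _).mpr ⟨hHW a ha w hw, ?_⟩
          rw [leibniz_lie, hH h h.2 a ha, zero_lie, zero_add, hw', lie_smul]) rfl
      exact ⟨χ, y, inf_le_left (a := W) hy, hy0, hχ⟩

end WeightVectors

/-! ### Uniqueness of the nonzero weight of `H`. -/

section RankOne

variable {p : ℕ} {k L : Type*} [Field k] [LieRing L] [LieAlgebra k L]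

/-- The properties, used below, of the centralizer `H` of a torus of maximal dimension in the
centralizer of a nonzero element `x` of the nullcone of a restricted Lie algebra of `p`-rank one. -/
structure IsRankOneCartan (P : PMap p k L) (H : LieSubalgebra k L) (x : L) : Prop where
  mem : x ∈ H
  map_eq_zero : P x = 0
  lie_eq_zero : ∀ a ∈ H, ∀ b ∈ H, ⁅a, b⁆ = 0
  mem_of_lie_eq_zero : ∀ y : L, (∀ h ∈ H, ⁅y, h⁆ = 0) → y ∈ H
  mem_of_map_eq_zero : ∀ w : L, P w = 0 → ⁅w, x⁆ = 0 → w ∈ H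
  exists_dual : ∃ l : Module.Dual k L, ∀ h ∈ H, l h = 0 → ∃ h' ∈ H, P h' = h
  lie_eq_zero_of_lie_lie_eq_zero : ∀ z w : L, ⁅z, x⁆ = 0 → ⁅w, x⁆ = 0 → ⁅z, ⁅z, w⁆⁆ = 0 →
    ⁅w, ⁅z, w⁆⁆ = 0 → ⁅z, w⁆ = 0

namespace IsRankOneCartan

variable {P : PMap p k L} {H : LieSubalgebra k L} {x : L} {χ ψ : H → k} {y z : L}

theorem mem_of_isWeightVector (hH : IsRankOneCartan P H x) (hy : IsWeightVector H 0 y) :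
    y ∈ H :=
  hH.mem_of_lie_eq_zero y fun h hh ↦ by
    rw [hy.lie_right ⟨h, hh⟩, Pi.zero_apply, zero_smul, neg_zero]

/-- The eigenvalue of `ad x` is zero, because its `p`-th power is an eigenvalue of `ad (P x) = 0`.
-/
theorem lie_eq_zero_of_isWeightVector (hH : IsRankOneCartan P H x) (hp : p ≠ 0)
    (hy : IsWeightVector H χ y) : ⁅y, x⁆ = 0 := by
  have h := hy.ad_pow ⟨x, hH.mem⟩ p
  rw [← P.lie_apply, hH.map_eq_zero, zero_lie] at h
  rcases smul_eq_zero.mp h.symm with h | rfl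
  · rw [hy.lie_right ⟨x, hH.mem⟩, (pow_eq_zero_iff hp).mp h, zero_smul, neg_zero]
  · exact zero_lie x

theorem map_mem_of_isWeightVector (hH : IsRankOneCartan P H x) (hp : 2 ≤ p)
    (hy : IsWeightVector H χ y) : P y ∈ H :=
  hH.mem_of_lie_eq_zero _ fun h hh ↦ P.lie_apply_eq_zero_of_pow (m := 2) (by
    rw [pow_two, Module.End.mul_apply, LieAlgebra.ad_apply, LieAlgebra.ad_apply,
      hy.lie_right ⟨h, hh⟩, lie_neg, lie_smul, lie_self, smul_zero, neg_zero]) hp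

/-- If the `p`-th power of a sum of weight vectors is a `p`-th power in `H`, then the components of
nonzero weight vanish. -/
theorem eq_zero_of_map_eq [Fact p.Prime] (hH : IsRankOneCartan P H x) (hp : 3 ≤ p)
    (hy : IsWeightVector H χ y) (hz : IsWeightVector H ψ z) (hχ : χ ≠ 0) (hψ : ψ ≠ 0) (hne : χ ≠ ψ)
    {a h : L} (ha : a ∈ H) (hh : h ∈ H) (hP : P (y + z + a) = P h) : y = 0 ∧ z = 0 := by
  have hp0 : p ≠ 0 := by omega
  -- An element commutes with its own `p`-th power. Since `P h` acts on weight vectors by the `p`-th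
  -- powers of the eigenvalues of `h`, already `h` commutes with `y + z + a`; the difference then
  -- lies in the nullcone.
  have h1 : ⁅P h, y + z + a⁆ = 0 := by rw [← hP]; exact P.lie_apply_self hp0 _
  have hha := hH.lie_eq_zero h hh a ha
  rw [lie_add, P.lie_apply_eq_zero hp0 hha, add_zero, P.lie_apply, map_add, hy.ad_pow ⟨h, hh⟩,
    hz.ad_pow ⟨h, hh⟩] at h1
  obtain ⟨hy0, hz0⟩ := (hy.smul _).eq_zero_of_add_eq_zero (hz.smul _) hne h1
  have hzero : ∀ {c : k} {v : L}, c ^ p • v = 0 → c • v = 0 := fun {c v} hcv ↦ by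
    rcases smul_eq_zero.mp hcv with h | rfl
    · rw [(pow_eq_zero_iff hp0).mp h, zero_smul]
    · exact smul_zero c
  have hcomm : ⁅y + z + a, h⁆ = 0 := by
    rw [← lie_skew, lie_add, lie_add, hha, hy ⟨h, hh⟩, hz ⟨h, hh⟩, hzero hy0, hzero hz0]
    simp
  have hmem : y + z + a - h ∈ H := by
    refine hH.mem_of_map_eq_zero _ (by rw [P.map_sub_of_commute hp hcomm, hP, sub_self]) ?_
    rw [sub_lie, add_lie, add_lie, hH.lie_eq_zero_of_isWeightVector hp0 hy,
      hH.lie_eq_zero_of_isWeightVector hp0 hz, hH.lie_eq_zero a ha x hH.mem,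
      hH.lie_eq_zero h hh x hH.mem]
    simp
  have hyz : y + z ∈ H := by
    have := H.sub_mem (H.add_mem hmem hh) ha
    rwa [sub_add_cancel, add_sub_cancel_right] at this
  have h2 : ∀ b : H, χ b • y = 0 ∧ ψ b • z = 0 := fun b ↦ by
    refine (hy.smul _).eq_zero_of_add_eq_zero (hz.smul _) hne ?_
    rw [← hy b, ← hz b, ← lie_add]
    exact hH.lie_eq_zero b b.2 _ hyz
  constructor
  · obtain ⟨b, hb⟩ := Function.ne_iff.mp hχ
    exact (smul_eq_zero.mp (h2 b).1).resolve_left hb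
  · obtain ⟨b, hb⟩ := Function.ne_iff.mp hψ
    exact (smul_eq_zero.mp (h2 b).2).resolve_left hb

/-- If `y` and `z` commuted, `P` would be semilinear on their span with values in `H`. Extracting a
`p`-th root then yields a nontrivial combination whose `p`-th power is killed by `l`, against
`eq_zero_of_map_eq`. -/
theorem lie_ne_zero [Fact p.Prime] [IsAlgClosed k] (hH : IsRankOneCartan P H x) (hp : 3 ≤ p)
    (hy : IsWeightVector H χ y) (hz : IsWeightVector H ψ z) (hχ : χ ≠ 0) (hψ : ψ ≠ 0) (hne : χ ≠ ψ)
    (hy0 : y ≠ 0) (hz0 : z ≠ 0) : ⁅y, z⁆ ≠ 0 := by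
  intro hyz
  obtain ⟨l, hl⟩ := hH.exists_dual
  have key : ∀ c d : k, l (P (c • y + d • z)) = 0 → c • y = 0 ∧ d • z = 0 := by
    intro c d hcd
    have hadd : P (c • y + d • z) = c ^ p • P y + d ^ p • P z := by
      rw [P.map_add_of_commute hp (by rw [smul_lie, lie_smul, hyz, smul_zero, smul_zero]),
        P.smul_toFun, P.smul_toFun]
    have hmem : P (c • y + d • z) ∈ H := by
      rw [hadd]
      exact H.add_mem (H.smul_mem _ (hH.map_mem_of_isWeightVector (by omega) hy))
        (H.smul_mem _ (hH.map_mem_of_isWeightVector (by omega) hz))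
    obtain ⟨h, hh, hPh⟩ := hl _ hmem hcd
    exact hH.eq_zero_of_map_eq hp (hy.smul c) (hz.smul d) hχ hψ hne H.zero_mem hh
      (by rw [add_zero, hPh])
  by_cases hlz : l (P z) = 0
  · exact hz0 (by simpa using (key 0 1 (by simpa using hlz)).2)
  · obtain ⟨d, hd⟩ := IsAlgClosed.exists_pow_nat_eq (-l (P y) / l (P z)) (n := p) (by omega)
    refine hy0 ((one_smul k y).symm.trans (key 1 d ?_).1)
    rw [P.map_add_of_commute hp (by rw [smul_lie, lie_smul, hyz, smul_zero, smul_zero]),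
      P.smul_toFun, P.smul_toFun, hd, map_add, map_smul, map_smul, smul_eq_mul, smul_eq_mul,
      div_mul_cancel₀ _ hlz, one_pow]
    ring

theorem lie_eq_zero_of_sl2 [Fact p.Prime] [IsAlgClosed k] [CharP k p] (hH : IsRankOneCartan P H x)
    (hp : 3 ≤ p) {e f : L} (he : IsWeightVector H χ e) (hf : IsWeightVector H (-χ) f)
    (hχ : χ ≠ 0) (hne : χ ≠ -χ) {h : H} (hef : ⁅e, f⁆ = (h : L)) (hh : χ h = 2) :
    e = 0 ∨ f = 0 := by
  have hp0 : p ≠ 0 := by omega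
  obtain ⟨l, hl⟩ := hH.exists_dual
  -- The elements `w` on this conic are the nilpotent elements of `sl2`.
  obtain ⟨a, b, hab, hlab⟩ := P.exists_conic_zero hp0 l e (-(h : L)) (-f)
  set w := a ^ 2 • e + (a * b) • (-(h : L)) + b ^ 2 • (-f) with hw
  have hhe : ⁅(h : L), e⁆ = (2 : k) • e := by rw [he h, hh]
  have hhf : ⁅(h : L), f⁆ = (-2 : k) • f := by rw [hf h, Pi.neg_apply, hh]
  have hws : ⁅w, a ^ 2 • e + b ^ 2 • f⁆ = (-2 * a * b) • w := by
    have hfe : ⁅f, e⁆ = -(h : L) := by rw [← lie_skew, hef]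
    rw [hw]
    simp only [add_lie, lie_add, smul_lie, lie_smul, neg_lie, hef, hfe, hhe, hhf, lie_self,
      smul_add, smul_neg, smul_zero, smul_smul, add_zero, zero_add, neg_neg, neg_zero]
    module
  have hwτ : ∀ τ : H, ⁅w, (τ : L)⁆ = (-χ τ) • (a ^ 2 • e + b ^ 2 • f) := by
    intro τ
    rw [hw]
    simp only [add_lie, smul_lie, neg_lie, he.lie_right, hf.lie_right, Pi.neg_apply,
      hH.lie_eq_zero h h.2 τ τ.2]
    module
  -- With `s = a ^ 2 • e + b ^ 2 • f`, `ad w` sends `H` into `k s` and `s` into `k w`, so its cube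
  -- kills `H`, and `p ≥ 3`.
  have hmem : P w ∈ H := by
    refine hH.mem_of_lie_eq_zero _ fun τ hτ ↦ P.lie_apply_eq_zero_of_pow (m := 3) ?_ hp
    simp only [pow_succ, pow_zero, one_mul, Module.End.mul_apply, LieAlgebra.ad_apply]
    rw [hwτ ⟨τ, hτ⟩, lie_smul, hws, lie_smul, lie_smul, lie_self, smul_zero, smul_zero]
  obtain ⟨u, hu, hPu⟩ := hl _ hmem hlab
  have hw' : w = a ^ 2 • e + (-b ^ 2) • f + (-(a * b)) • (h : L) := by rw [hw]; module
  rw [hw'] at hPu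
  obtain ⟨h1, h2⟩ := hH.eq_zero_of_map_eq hp (he.smul _) (hf.smul _) hχ (neg_ne_zero.mpr hχ) hne
    (H.smul_mem _ h.2) hu hPu.symm
  rcases hab with ha | hb
  · exact Or.inl ((smul_eq_zero.mp h1).resolve_left (pow_ne_zero 2 ha))
  · exact Or.inr ((smul_eq_zero.mp h2).resolve_left (neg_ne_zero.mpr (pow_ne_zero 2 hb)))

/-- Nonzero weights of `H` are unique. -/
theorem weight_unique [Fact p.Prime] [IsAlgClosed k] [CharP k p] (hH : IsRankOneCartan P H x)
    (hp : 3 ≤ p) (hy : IsWeightVector H χ y) (hz : IsWeightVector H ψ z) (hχ : χ ≠ 0) (hψ : ψ ≠ 0)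
    (hy0 : y ≠ 0) (hz0 : z ≠ 0) : χ = ψ := by
  by_contra hne
  have hp0 : p ≠ 0 := by omega
  have h2 : (2 : k) ≠ 0 := by
    intro h
    have := (CharP.cast_eq_zero_iff k p 2).mp (by exact_mod_cast h)
    exact absurd (Nat.le_of_dvd two_pos this) (by omega)
  let R : Set (H → k) := {χ | χ ≠ 0 ∧ ∃ y ≠ 0, IsWeightVector H χ y}
  obtain ⟨η, ⟨hη, e, he0, he⟩, -, f, hf0, hf⟩ := exists_mem_neg_mem_of_add_mem (R := R) (p := p) hp0
    (fun m ↦ by ext; simp) (fun h ↦ h.1 rfl) (by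
      rintro χ ⟨hχ, y, hy0, hy⟩ ψ ⟨hψ, z, hz0, hz⟩ hne
      exact or_iff_not_imp_left.mpr fun h ↦
        ⟨h, _, hH.lie_ne_zero hp hy hz hχ hψ hne hy0 hz0, hy.lie hz⟩)
    ⟨hχ, y, hy0, hy⟩ ⟨hψ, z, hz0, hz⟩ hne
  have hηne : η ≠ -η := by
    intro h
    refine hη (funext fun a ↦ ?_)
    have ha : (2 : k) * η a = 0 := by
      rw [two_mul]
      exact add_eq_zero_iff_eq_neg.mpr (congrFun h a)
    exact (mul_eq_zero.mp ha).resolve_left h2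
  have hef := hH.lie_ne_zero hp he hf hη (neg_ne_zero.mpr hη) hηne he0 hf0
  have hmem : ⁅e, f⁆ ∈ H := hH.mem_of_isWeightVector (by simpa using he.lie hf)
  -- If `η` vanishes on the bracket, `e` and `f` generate a Heisenberg algebra; otherwise rescaling
  -- `f` gives an `sl2`-triple.
  by_cases hc : η ⟨⁅e, f⁆, hmem⟩ = 0
  · refine hef (hH.lie_eq_zero_of_lie_lie_eq_zero e f (hH.lie_eq_zero_of_isWeightVector hp0 he)
      (hH.lie_eq_zero_of_isWeightVector hp0 hf) ?_ ?_)
    · rw [he.lie_right ⟨_, hmem⟩, hc, zero_smul, neg_zero]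
    · rw [hf.lie_right ⟨_, hmem⟩, Pi.neg_apply, hc, neg_zero, zero_smul, neg_zero]
  · set c := η ⟨⁅e, f⁆, hmem⟩ with hcdef
    have hscale : η ((2 / c) • ⟨⁅e, f⁆, hmem⟩) = 2 := by
      have h1 := he ((2 / c) • ⟨⁅e, f⁆, hmem⟩)
      have h3 := he ⟨⁅e, f⁆, hmem⟩
      rw [← hcdef] at h3
      change ⁅(2 / c) • ⁅e, f⁆, e⁆ = _ at h1
      change ⁅⁅e, f⁆, e⁆ = _ at h3
      rw [smul_lie, h3, smul_smul, div_mul_cancel₀ _ hc] at h1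
      exact (smul_left_injective k he0 h1).symm
    rcases hH.lie_eq_zero_of_sl2 hp he (hf.smul (2 / c)) hη hηne
      (h := (2 / c) • ⟨⁅e, f⁆, hmem⟩) (by simp [lie_smul]) hscale with h | h
    · exact he0 h
    · exact hf0 ((smul_eq_zero.mp h).resolve_left (div_ne_zero h2 hc))

end IsRankOneCartan

end RankOne

/-- Every root is the restriction of a weight of an abelian subalgebra centralizing the torus. -/
theorem exists_isWeightVector_of_mem_roots {k L : Type*} [Field k] [IsAlgClosed k]
    [LieRing L] [LieAlgebra k L] [FiniteDimensional k L] {t H : LieSubalgebra k L} (htH : t ≤ H)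
    (hab : ∀ a ∈ H, ∀ b ∈ H, ⁅a, b⁆ = 0) {α : Module.Dual k t} (hα : α ∈ roots t) :
    ∃ χ : H → k, ∃ y ≠ 0, IsWeightVector H χ y ∧
      ∀ τ (hτ : τ ∈ t), χ ⟨τ, htH hτ⟩ = α ⟨τ, hτ⟩ := by
  have hmem : ∀ y, y ∈ LieModule.weightSpace L (α : t → k) ↔
      ∀ τ (hτ : τ ∈ t), ⁅τ, y⁆ = α ⟨τ, hτ⟩ • y := fun y ↦ by
    rw [LieModule.mem_weightSpace]
    exact ⟨fun h τ hτ ↦ h ⟨τ, hτ⟩, fun h τ ↦ h τ τ.2⟩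
  obtain ⟨χ, y, hy, hy0, hχ⟩ := exists_isWeightVector hab
    (LieModule.weightSpace L (α : t → k)).toSubmodule
    (fun h ↦ hα.2 ((LieSubmodule.toSubmodule_eq_bot _).mp h)) (fun a ha w hw ↦ by
      refine (hmem _).mpr fun τ hτ ↦ ?_
      rw [leibniz_lie, hab τ (htH hτ) a ha, zero_lie, zero_add, (hmem w).mp hw τ hτ, lie_smul])
  refine ⟨χ, y, hy0, hχ, fun τ hτ ↦ smul_left_injective k hy0 ?_⟩
  exact (hχ ⟨τ, htH hτ⟩).symm.trans ((hmem y).mp hy τ hτ)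

/-! ### Assembling the contradiction. -/

section Main

variable {p : ℕ} [Fact p.Prime] {k L : Type*} [Field k] [IsAlgClosed k] [CharP k p] [LieRing L]
  [LieAlgebra k L] [FiniteDimensional k L] {P : PMap p k L} {t : LieSubalgebra k L}

theorem IsMaxDimTorus.isRankOneCartan (hp : 3 ≤ p) (hrank : pRank P = 1) (ht : IsMaxDimTorus P t)
    {x : L} (hx : x ∈ centralizer t) (hx0 : x ≠ 0) (hPx : P x = 0) :
    IsRankOneCartan P (centralizerAdjoin t x) x := by
  have hp0 : p ≠ 0 := by omega
  have hxH : x ∈ centralizerAdjoin t x := ⟨hx, lie_self x⟩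
  have htH : t ≤ centralizerAdjoin t x := fun τ hτ ↦
    ⟨ht.1.le_centralizer hτ, lie_eq_zero_comm.mp (hx τ hτ)⟩
  have hab : ∀ a ∈ centralizerAdjoin t x, ∀ b ∈ centralizerAdjoin t x, ⁅a, b⁆ = 0 :=
    fun a ha b hb ↦ lie_eq_zero_of_mem_centralizerAdjoin hp hrank ht hx0 hPx ha hb
  refine
    { mem := hxH
      map_eq_zero := hPx
      lie_eq_zero := hab
      mem_of_lie_eq_zero := fun y hy ↦ ⟨fun τ hτ ↦ hy τ (htH hτ), hy x hxH⟩
      mem_of_map_eq_zero := fun w hw hwx ↦ ?_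
      exists_dual := ?_
      lie_eq_zero_of_lie_lie_eq_zero := fun z w hz hw ↦
        lie_eq_zero_of_lie_lie_eq_zero hp hrank hx0 hPx hz hw }
  · obtain ⟨c, rfl⟩ := exists_smul_eq_of_pRank_eq_one hp hrank hPx hw
      (lie_eq_zero_comm.mp hwx) hx0
    exact (centralizerAdjoin t x).smul_mem c hxH
  · let A : Submodule k L := (centralizerAdjoin t x).toSubmodule
    have hadd : ∀ a ∈ A, ∀ b ∈ A, P (a + b) = P a + P b := fun a ha b hb ↦
      P.map_add_of_commute hp (hab a ha b hb)
    set B := LinearMap.range (P.semilinear A hadd) with hB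
    have hBA : B ≤ A := by
      rintro _ ⟨a, rfl⟩
      exact P.map_mem_centralizerAdjoin hp0 a.2
    have hdim : Module.finrank k A ≤ Module.finrank k B + 1 :=
      finrank_le_finrank_range_add_one hp hrank hx0 hPx A hadd fun a ha ↦ ha.2
    have hmem : ∀ h ∈ B, ∃ h' ∈ centralizerAdjoin t x, P h' = h := by
      rintro _ ⟨a, rfl⟩
      exact ⟨a, a.2, rfl⟩
    -- `B` has codimension at most one in `A`. If it is proper, a form vanishing on `B` but not on
    -- `A` cuts out exactly `B`.
    by_cases hAB : A ≤ B
    · exact ⟨0, fun h hh _ ↦ hmem h (hAB hh)⟩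
    · obtain ⟨v, hvA, hvB⟩ := SetLike.not_le_iff_exists.mp hAB
      obtain ⟨l, hlv, hl⟩ := Submodule.exists_le_ker_of_notMem hvB
      have hlt : A ⊓ LinearMap.ker l < A :=
        lt_of_le_of_ne inf_le_left fun heq ↦ hlv (inf_le_right (a := A) (heq.symm ▸ hvA))
      have hrk := Submodule.finrank_lt_finrank_of_lt hlt
      have heq : B = A ⊓ LinearMap.ker l :=
        Submodule.eq_of_le_of_finrank_le (le_inf hBA hl) (by omega)
      exact ⟨l, fun h hh hlh ↦ hmem h (heq ▸ ⟨hh, hlh⟩)⟩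

theorem IsMaxDimTorus.centralizer_eq (hp : 3 ≤ p) (hrank : pRank P = 1) (ht : IsMaxDimTorus P t)
    (hroots : 2 ≤ (roots t).encard) : centralizer t = t := by
  by_contra hne
  obtain ⟨x, hx, hx0, hPx⟩ := ht.exists_ne_zero_map_eq_zero hp hne
  have hH := ht.isRankOneCartan hp hrank hx hx0 hPx
  have htH : t ≤ centralizerAdjoin t x := fun τ hτ ↦
    ⟨ht.1.le_centralizer hτ, lie_eq_zero_comm.mp (hx τ hτ)⟩
  obtain ⟨α, β, hα, hβ, hαβ⟩ := Set.one_lt_encard_iff.mp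
    (lt_of_lt_of_le (by norm_num) hroots : 1 < (roots t).encard)
  obtain ⟨χ, y, hy0, hy, hχ⟩ := exists_isWeightVector_of_mem_roots htH hH.lie_eq_zero hα
  obtain ⟨ψ, z, hz0, hz, hψ⟩ := exists_isWeightVector_of_mem_roots htH hH.lie_eq_zero hβ
  -- The weights restrict to `α` and `β` on `t`, so they are nonzero, and their equality forces `α =
  -- β`.
  have hχψ : χ = ψ := hH.weight_unique hp hy hz
    (fun h ↦ hα.1 (LinearMap.ext fun τ ↦ by rw [← hχ τ τ.2, h]; rfl))
    (fun h ↦ hβ.1 (LinearMap.ext fun τ ↦ by rw [← hψ τ τ.2, h]; rfl)) hy0 hz0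
  exact hαβ (LinearMap.ext fun τ ↦ by rw [← hχ τ τ.2, ← hψ τ τ.2, hχψ])

end Main

end RestrictedLie

theorem proposition3p1 {k : Type*} [Field k] [IsAlgClosed k] (p : ℕ) [Fact p.Prime] [CharP k p]
    (hp : 3 ≤ p) {g : Type*} [LieRing g] [LieAlgebra k g] [FiniteDimensional k g]
    (P : RestrictedLie.PMap p k g) (hrank : RestrictedLie.pRank P = 1)
    (t : LieSubalgebra k g) (ht : RestrictedLie.IsMaxDimTorus P t)
    (hroots : 2 ≤ (RestrictedLie.roots t).encard) :
    RestrictedLie.IsGenericallyToral P ∧ RestrictedLie.centralizer t = t :=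
  have h := ht.centralizer_eq hp hrank hroots
  ⟨⟨t, ht.1, h⟩, h⟩
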